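/- Let $G$ be a permutation group on a finite set $\Omega$. We say that $G$ has the \emph{road closure property} if, for every orbit $O$ of $G$ on the $2$-element subsets of $\Omega$ and every maximal (proper) block of imprimitivity $B$ for $G$ acting on $O$, the graph with vertex set $\Omega$ and edge set $O\setminus B$ is connected. A group is \emph{imprimitive} if it preserves a partition of $\Omega$ other than the partition into singletons and the partition with one part; a transitive group is \emph{primitive} if it is not imprimitive. A primitive group is \emph{basic} if it preserves no non-trivial Cartesian power structure on $\Omega$, that is, if there is no identification of $\Omega$ with $Q^d$, where $|Q|\ge 2$ and $d\ge 2$, under which $G$ is contained in the wreath product $\mathrm{Sym}(Q)\wr S_d$ in its product action. Theorem. (a) A transitive imprimitive group fails the road closure property. (b) A primitive non-basic group fails the road closure property. (c) A primitive group which has an imprimitive normal subgroup of index $2$ fails the road closure property. (d) Let $q$ be a prime power, and consider the polar space of the quadratic form $x_1y_1+x_2y_2+x_3y_3+x_4y_4$ of plus type on $\mathbb{F}_q^8$. Its objects are of three types: the points (totally singular $1$-dimensional subspaces), and the solids (totally singular $4$-dimensional subspaces) of each of the two families, two solids belonging to the same family when the dimension of their intersection is even. A point and a solid are incident if the solid contains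 the point; two solids of different families are incident if their intersection has dimension $3$. A correlation is a permutation of the objects which preserves incidence and permutes the three types. The group $\mathrm{P}\Omega^+(8,q)$ is the group of correlations induced by $\Omega^+(8,q)$, the commutator subgroup of the orthogonal group of the form. Let $G=\mathrm{P}\Omega^+(8,q):S_3$, that is, let $G$ be a group of correlations whose subgroup of type-preserving elements is $\mathrm{P}\Omega^+(8,q)$ and which induces the symmetric group $S_3$ on the three types. Then $G$, in its action on the set of triples of mutually incident objects consisting of a point and a solid from each of the two families, fails the road closure property. -/

import Mathlib

section PermutationGroups

variable (G : Type*) [Group G] (Ω : Type*) [MulAction G Ω]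

/-- `G` preserves a non-trivial partition of `Ω`: an invariant equivalence relation which is
neither equality nor the universal relation. -/
def PreservesNontrivialPartition : Prop :=
  ∃ r : Setoid Ω, r ≠ ⊥ ∧ r ≠ ⊤ ∧ ∀ (g : G) (x y : Ω), r x y → r (g • x) (g • y)

/-- `G` preserves a non-trivial Cartesian power structure on `Ω`: there is an identification of
`Ω` with the set of `d`-tuples over an alphabet of size `q` (with `d ≥ 2` and `q ≥ 2`) such that
every element of `G` acts as an element of the wreath product `Sym(q) ≀ Sym(d)` in its product
action, that is, by permuting the coordinates and then applying a permutation of the alphabet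
in each coordinate. -/
def PreservesNontrivialCartesianPower : Prop :=
  ∃ q d : ℕ, 2 ≤ q ∧ 2 ≤ d ∧ ∃ e : Ω ≃ (Fin d → Fin q), ∀ g : G,
    ∃ (σ : Equiv.Perm (Fin d)) (τ : Fin d → Equiv.Perm (Fin q)),
      ∀ (ω : Ω) (i : Fin d), e (g • ω) i = τ i (e ω (σ i))

/-- A group is basic if it is primitive and preserves no non-trivial Cartesian power structure. -/
def IsBasic : Prop :=
  MulAction.IsPreprimitive G Ω ∧ ¬ PreservesNontrivialCartesianPower G Ω

/-- The graph with vertex set `Ω` and edge set `E`, a set of `2`-subsets of `Ω`. -/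
def graphOfTwoSets {Ω : Type*} (E : Set (Set.powersetCard Ω 2)) : SimpleGraph Ω where
  Adj x y := x ≠ y ∧ ∃ s ∈ E, x ∈ s ∧ y ∈ s
  symm := ⟨fun _ _ h => ⟨h.1.symm, h.2.imp fun _ k => ⟨k.1, k.2.2, k.2.1⟩⟩⟩
  loopless := ⟨fun _ h => h.1 rfl⟩

open Classical in
/-- `B` is a (non-empty, proper) block of imprimitivity for `G` acting on the set `O` of
`2`-sets. -/
def IsProperBlockIn (O B : Set (Set.powersetCard Ω 2)) : Prop :=
  B.Nonempty ∧ B ⊂ O ∧ MulAction.IsBlock G B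

open Classical in
/-- The road closure property: for every orbit `O` of `G` on `2`-sets, and every maximal block of
imprimitivity `B` for `G` acting on `O`, the graph with vertex set `Ω` and edge set `O \ B` is
connected. -/
def RoadClosure : Prop :=
  ∀ (s : Set.powersetCard Ω 2) (B : Set (Set.powersetCard Ω 2)),
    Maximal (IsProperBlockIn G Ω (MulAction.orbit G s)) B →
      (graphOfTwoSets (MulAction.orbit G s \ B)).Connected

end PermutationGroups

section Triality

variable (F : Type*) [Field F]

/-- The `8`-dimensional vector space over `F`, written as `F⁴ × F⁴`. -/
abbrev Space8 : Type _ := (Fin 4 → F) × (Fin 4 → F)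

variable {F} in
/-- The hyperbolic quadratic form `x₁y₁ + x₂y₂ + x₃y₃ + x₄y₄`, of plus type. -/
def hypForm (v : Space8 F) : F := ∑ i, v.1 i * v.2 i

/-- The orthogonal group `O⁺(8,F)`. -/
def orthogonalGroup8 : Subgroup (Space8 F ≃ₗ[F] Space8 F) where
  carrier := {g | ∀ v, hypForm (g v) = hypForm v}
  one_mem' := fun _ => rfl
  mul_mem' := fun {a b} ha hb v => (ha (b v)).trans (hb v)
  inv_mem' := fun {a} ha v => by
    have h := ha (a⁻¹ v)
    have h2 : a (a⁻¹ v) = v := a.apply_symm_apply v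
    rw [h2] at h
    exact h.symm

/-- The group `Ω⁺(8,F)`, the commutator subgroup of `O⁺(8,F)`. -/
def omegaGroup8 : Subgroup (Space8 F ≃ₗ[F] Space8 F) :=
  ⁅orthogonalGroup8 F, orthogonalGroup8 F⁆

variable {F}

/-- Totally singular subspaces. -/
def TotallySingular (U : Submodule F (Space8 F)) : Prop := ∀ v ∈ U, hypForm v = 0

/-- The totally singular `4`-space `F⁴ × 0`; the first family of solids is the one containing
it. -/
def baseSolid : Submodule F (Space8 F) := LinearMap.ker (LinearMap.snd F (Fin 4 → F) (Fin 4 → F))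

/-- The three types of object of the polar space: type `0` is a point (a totally singular
`1`-space); types `1` and `2` are the solids (totally singular `4`-spaces, that is, projective
`3`-spaces) of the two families. Two solids belong to the same family when their intersection has
even vector space dimension. -/
def IsObjectOfType (i : Fin 3) (U : Submodule F (Space8 F)) : Prop :=
  TotallySingular U ∧
    ((i = 0 ∧ Module.finrank F U = 1) ∨
     (i = 1 ∧ Module.finrank F U = 4 ∧ Even (Module.finrank F ↥(U ⊓ baseSolid))) ∨
     (i = 2 ∧ Module.finrank F U = 4 ∧ Odd (Module.finrank F ↥(U ⊓ baseSolid))))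

variable (F) in
/-- The objects of the polar space: points, and solids of either family. -/
structure PolarObject where
  /-- The type of the object: `0` for points, `1` and `2` for the two families of solids. -/
  type : Fin 3
  /-- The underlying subspace. -/
  space : Submodule F (Space8 F)
  isObject : IsObjectOfType type space

/-- Incidence of objects: a point and a solid are incident when the point lies on the solid, and
solids of different families are incident when they meet in a plane, that is, in a `3`-dimensional
subspace. (Distinct objects of the same type are never incident.) -/
def Incident (a b : PolarObject F) : Prop :=
  a.space ≤ b.space ∨ b.space ≤ a.space ∨ Module.finrank F ↥(a.space ⊓ b.space) = 3

variable (F) in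
/-- The group of correlations of the polar space: the permutations of its objects which preserve
incidence and permute the three types, each recorded together with the permutation of the types
that it induces. -/
def Correlation : Subgroup (Equiv.Perm (PolarObject F) × Equiv.Perm (Fin 3)) where
  carrier := {c | (∀ a, (c.1 a).type = c.2 a.type) ∧
    ∀ a b, Incident (c.1 a) (c.1 b) ↔ Incident a b}
  one_mem' := ⟨fun _ => rfl, fun _ _ => Iff.rfl⟩
  mul_mem' := fun {c d} hc hd =>
    ⟨fun a => (hc.1 (d.1 a)).trans (congrArg c.2 (hd.1 a)),
      fun a b => (hc.2 (d.1 a) (d.1 b)).trans (hd.2 a b)⟩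
  inv_mem' := fun {c} hc => by
    have key : ∀ a, c.1 (c.1⁻¹ a) = a := fun a => c.1.apply_symm_apply a
    refine ⟨fun a => ?_, fun a b => ?_⟩
    · have h := hc.1 (c.1⁻¹ a)
      rw [key] at h
      exact (Equiv.Perm.inv_eq_iff_eq.mpr h).symm
    · have h := hc.2 (c.1⁻¹ a) (c.1⁻¹ b)
      rw [key, key] at h
      exact h.symm

variable (F) in
/-- The action of correlations on the three types. -/
def typeHom : Correlation F →* Equiv.Perm (Fin 3) :=
  (MonoidHom.snd _ _).comp (Correlation F).subtype

variable (F) in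
/-- The group `PΩ⁺(8,F)`: the group of correlations induced by elements of `Ω⁺(8,F)`. -/
def pOmega8 : Subgroup (Correlation F) where
  carrier := {c | ∃ g ∈ omegaGroup8 F,
    ∀ a, (c.1.1 a).space = a.space.map (g : Space8 F →ₗ[F] Space8 F)}
  one_mem' := ⟨1, one_mem _, fun a => (Submodule.map_id a.space).symm⟩
  mul_mem' := by
    rintro c d ⟨g, hg, hc⟩ ⟨h, hh, hd⟩
    refine ⟨g * h, mul_mem hg hh, fun a => ?_⟩
    change (c.1.1 (d.1.1 a)).space = _
    rw [hc, hd, ← Submodule.map_comp]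
    rfl
  inv_mem' := by
    rintro c ⟨g, hg, hc⟩
    refine ⟨g⁻¹, inv_mem hg, fun a => ?_⟩
    have h := hc (c.1.1⁻¹ a)
    have key : c.1.1 (c.1.1⁻¹ a) = a := c.1.1.apply_symm_apply a
    rw [key] at h
    have hcomp : ((g⁻¹ : Space8 F ≃ₗ[F] Space8 F) : Space8 F →ₗ[F] Space8 F) ∘ₗ
        (g : Space8 F →ₗ[F] Space8 F) = LinearMap.id :=
      LinearMap.ext fun v => g.symm_apply_apply v
    rw [h, ← Submodule.map_comp, hcomp, Submodule.map_id]
    rfl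

/-- `G` is a group `PΩ⁺(8,F) : S₃` of correlations of the polar space: its subgroup of
type-preserving elements is `PΩ⁺(8,F)`, and it induces the symmetric group `S₃` on the three types
of object. -/
structure IsTrialityGroup (G : Subgroup (Correlation F)) : Prop where
  typePreserving : G ⊓ (typeHom F).ker = pOmega8 F
  induces : G.map (typeHom F) = ⊤

variable (F) in
/-- The triples of mutually incident objects consisting of a point and a solid from each
family. -/
@[ext]
structure IncidentTriple where
  obj : Fin 3 → PolarObject F
  type_obj : ∀ i, (obj i).type = i
  incident : ∀ i j, Incident (obj i) (obj j)

/-- The action of correlations on triples; the member of type `i` of `c • t` is the image under `c`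
of the member of `t` of the type which `c` maps to `i`. -/
instance : MulAction (Correlation F) (IncidentTriple F) where
  smul c t :=
    { obj := fun i => c.1.1 (t.obj (c.1.2⁻¹ i))
      type_obj := fun i => by
        rw [c.2.1, t.type_obj]
        exact c.1.2.apply_symm_apply i
      incident := fun i j => (c.2.2 _ _).mpr (t.incident _ _) }
  one_smul _ := rfl
  mul_smul _ _ _ := rfl

end Triality

/-! ### Disconnecting an orbit of pairs by deleting a block -/

section RoadClosureCriteria

variable {G : Type*} [Group G] {Ω : Type*} [MulAction G Ω]

/-! By finiteness any proper block in an orbit of pairs extends to a maximal one, and enlarging the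
block only deletes edges. So it suffices to find a proper block whose complement in the orbit lies
inside the classes of a non-universal equivalence relation (`not_roadClosure_of_block`). For (a),
take a pair inside a class of the invariant partition: its whole orbit stays inside classes, so the
block can be that single pair. For (b) and (d), points have coordinates permuted by the group; start
from two points differing only in coordinate `i`. Pairs in the orbit differ in just one coordinate;
those differing in `i` form the block and the others agree in `i`
(`not_roadClosure_of_coordinates`). In (d) the coordinates are the three members of a triple. For
(c), elements outside the index-two subgroup swap its partition with a second one; the orbit of a
pair inside a class of the first splits into pairs inside classes of the first (the block) and of
the second. -/

/-- A graph whose edges all lie inside the classes of a proper equivalence relation is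
disconnected. -/
theorem not_connected_graphOfTwoSets {E : Set (Set.powersetCard Ω 2)} {r : Setoid Ω} (hr : r ≠ ⊤)
    (hE : ∀ p ∈ E, ∀ x ∈ p, ∀ y ∈ p, r x y) : ¬ (graphOfTwoSets E).Connected := by
  intro hc
  refine hr (Setoid.ext fun x y => ⟨fun _ => trivial, fun _ => ?_⟩)
  obtain ⟨w⟩ := hc.preconnected x y
  clear * - w hE
  induction w with
  | nil => exact r.refl _
  | cons h _ ih =>
    obtain ⟨-, p, hp, hx, hy⟩ := h
    exact r.trans (hE p hp _ hx _ hy) ih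

open Classical in
theorem mem_smul_powersetCard_iff {g : G} {p : Set.powersetCard Ω 2} {x : Ω} :
    x ∈ g • p ↔ ∃ y ∈ p, g • y = x :=
  Finset.mem_smul_finset

/-- The `2`-set of two distinct points. -/
theorem exists_powersetCard_two {x y : Ω} (h : x ≠ y) :
    ∃ p : Set.powersetCard Ω 2, ∀ z, z ∈ p ↔ z = x ∨ z = y := by
  classical
  exact ⟨⟨{x, y}, Finset.card_pair h⟩, fun z => by
    change z ∈ ({x, y} : Finset Ω) ↔ _
    simp⟩

theorem exists_ne_mem_powersetCard_two (p : Set.powersetCard Ω 2) :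
    ∃ x ∈ p, ∃ y ∈ p, x ≠ y := by
  obtain ⟨x, hx, y, hy, h⟩ := Finset.one_lt_card.mp (p.2.symm ▸ one_lt_two : 1 < p.1.card)
  exact ⟨x, hx, y, hy, h⟩

open Classical in
/-- If a set `P` of `2`-sets cuts a proper block out of the orbit of `s`, and the rest of the orbit
lies inside the classes of a proper equivalence relation, then road closure fails. -/
theorem not_roadClosure_of_block [Finite Ω] (s : Set.powersetCard Ω 2)
    (P : Set (Set.powersetCard Ω 2)) (hs : s ∈ P) (hP : ∃ g : G, g • s ∉ P)
    (hblock : ∀ g : G, ∀ p ∈ MulAction.orbit G s, ∀ p' ∈ MulAction.orbit G s,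
      p ∈ P → g • p ∈ P → p' ∈ P → g • p' ∈ P)
    (r : Setoid Ω) (hr : r ≠ ⊤)
    (hE : ∀ p ∈ MulAction.orbit G s, p ∉ P → ∀ x ∈ p, ∀ y ∈ p, r x y) :
    ¬ RoadClosure G Ω := by
  intro hroad
  set O := MulAction.orbit G s with hO
  have hfin : Finite (Set.powersetCard Ω 2) := Subtype.finite
  have hproper : IsProperBlockIn G Ω O (O ∩ P) := by
    refine ⟨⟨s, MulAction.mem_orbit_self s, hs⟩, ⟨Set.inter_subset_left, fun h => ?_⟩, ?_⟩
    · obtain ⟨g, hg⟩ := hP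
      exact hg (h (MulAction.mem_orbit s g)).2
    · rw [MulAction.isBlock_iff_smul_eq_of_nonempty]
      rintro g ⟨q, hq, -, hqP⟩
      obtain ⟨p, ⟨hpO, hpP⟩, rfl⟩ := hq
      -- A translate has the same finite cardinality, so inclusion is enough.
      refine Set.eq_of_subset_of_ncard_le ?_ (Set.ncard_smul_set g (O ∩ P)).ge
        (Set.toFinite _)
      rintro _ ⟨p', ⟨hp'O, hp'P⟩, rfl⟩
      exact ⟨MulAction.mem_orbit_of_mem_orbit g hp'O, hblock g p hpO p' hp'O hpP hqP hp'P⟩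
  obtain ⟨B, hle, hB⟩ := (Set.toFinite {B | IsProperBlockIn G Ω O B}).exists_le_maximal hproper
  exact not_connected_graphOfTwoSets hr
    (fun p hp => hE p hp.1 fun h => hp.2 (hle ⟨hp.1, h⟩)) (hroad s B hB)

/-- If the group permutes coordinates, road closure fails as soon as two points differ in a single
coordinate which is not fixed by the whole group. -/
theorem not_roadClosure_of_coordinates [Finite Ω] {D Q : Type*} (c : Ω → D → Q) (σ : G → D → D)
    (hσ : ∀ g, Function.Injective (σ g))
    (hc : ∀ g x y i, c (g • x) i = c (g • y) i ↔ c x (σ g i) = c y (σ g i))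
    {x y : Ω} {i : D} (hxy : ∀ j, c x j = c y j ↔ j ≠ i) (hi : ∃ g, σ g i ≠ i) :
    ¬ RoadClosure G Ω := by
  classical
  have hne : c x i ≠ c y i := fun h => (hxy i).mp h rfl
  obtain ⟨s, hs⟩ := exists_powersetCard_two (ne_of_apply_ne (fun z => c z i) hne)
  -- The pair `g • s` can differ at `j` only if `σ g j = i`; injectivity of `σ g` then leaves at
  -- most one such `j`.
  have hdiff : ∀ g j, (∃ u ∈ g • s, ∃ v ∈ g • s, c u j ≠ c v j) → σ g j = i := by
    rintro g j ⟨_, hu, _, hv, h⟩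
    obtain ⟨u, hus, rfl⟩ := mem_smul_powersetCard_iff.mp hu
    obtain ⟨v, hvs, rfl⟩ := mem_smul_powersetCard_iff.mp hv
    rw [Ne, hc] at h
    rcases (hs u).mp hus with rfl | rfl <;> rcases (hs v).mp hvs with rfl | rfl
    · exact absurd rfl h
    · rwa [hxy, not_not] at h
    · rwa [eq_comm, hxy, not_not] at h
    · exact absurd rfl h
  have horbit : ∀ p ∈ MulAction.orbit G s, ∀ j k, (∃ u ∈ p, ∃ v ∈ p, c u j ≠ c v j) →
      (∃ u ∈ p, ∃ v ∈ p, c u k ≠ c v k) → j = k := by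
    rintro _ ⟨g, rfl⟩ j k hj hk
    exact hσ g ((hdiff g j hj).trans (hdiff g k hk).symm)
  refine not_roadClosure_of_block s {p | ∃ u ∈ p, ∃ v ∈ p, c u i ≠ c v i}
    ⟨x, (hs x).mpr (.inl rfl), y, (hs y).mpr (.inr rfl), hne⟩ ?_ ?_
    (Setoid.ker fun z => c z i) (fun h => hne ?_) fun p _ hpP u hu v hv => ?_
  · exact hi.imp fun g hg h => hg (hdiff g i h)
  · rintro g p hp p' - ⟨u, hu, v, hv, huv⟩ ⟨_, ha, _, hb, hab⟩ ⟨u', hu', v', hv', huv'⟩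
    obtain ⟨a, has, rfl⟩ := mem_smul_powersetCard_iff.mp ha
    obtain ⟨b, hbs, rfl⟩ := mem_smul_powersetCard_iff.mp hb
    rw [Ne, hc] at hab
    -- The pair `p` differs both at `σ g i` and at `i`, so these coincide.
    have hfix : σ g i = i := horbit p hp _ _ ⟨a, has, b, hbs, hab⟩ ⟨u, hu, v, hv, huv⟩
    refine ⟨g • u', mem_smul_powersetCard_iff.mpr ⟨u', hu', rfl⟩, g • v',
      mem_smul_powersetCard_iff.mpr ⟨v', hv', rfl⟩, ?_⟩
    rwa [Ne, hc, hfix]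
  · exact (show (Setoid.ker fun z => c z i) x y from h ▸ trivial)
  · by_contra h
    exact hpP ⟨u, hu, v, hv, h⟩

/-! ### Invariant partitions, Cartesian powers, subgroups of index two -/

/-- A primitive group preserves no non-trivial partition. -/
theorem not_preservesNontrivialPartition [MulAction.IsPreprimitive G Ω] :
    ¬ PreservesNontrivialPartition G Ω := by
  rintro ⟨r, hbot, htop, hr⟩
  obtain ⟨x, y, hxy, hne⟩ : ∃ x y, r x y ∧ x ≠ y := by
    by_contra! h
    exact hbot (eq_bot_iff.mpr fun x y => h x y)
  have hiff : ∀ (g : G) x y, r (g • x) (g • y) ↔ r x y := fun g x y =>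
    ⟨fun h => by simpa using hr g⁻¹ _ _ h, hr g x y⟩
  have hblock : MulAction.IsBlock G {z | r x z} := by
    rw [MulAction.isBlock_iff_smul_eq_of_nonempty]
    rintro g ⟨w, hw, hw'⟩
    have hgx : r x (g • x) := by
      rw [Set.mem_smul_set_iff_inv_smul_mem] at hw
      have h := hr g _ _ hw
      rw [smul_inv_smul] at h
      exact r.trans hw' (r.symm h)
    ext z
    rw [Set.mem_smul_set_iff_inv_smul_mem, Set.mem_ofPred_eq, Set.mem_ofPred_eq, ← hiff g,
      smul_inv_smul]
    exact ⟨r.trans hgx, r.trans (r.symm hgx)⟩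
  rcases MulAction.IsPreprimitive.isTrivialBlock_of_isBlock hblock with h | h
  · exact hne (h (r.refl x) hxy)
  · have hall : ∀ z, r x z := fun z => (Set.ext_iff.mp h z).mpr trivial
    exact htop (Setoid.ext fun a b =>
      ⟨fun _ => trivial, fun _ => r.trans (r.symm (hall a)) (hall b)⟩)

theorem not_roadClosure_of_imprimitive [Finite Ω] [MulAction.IsPretransitive G Ω]
    (h : PreservesNontrivialPartition G Ω) : ¬ RoadClosure G Ω := by
  classical
  obtain ⟨r, hbot, htop, hr⟩ := h
  obtain ⟨x, y, hxy, hne⟩ : ∃ x y, r x y ∧ x ≠ y := by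
    by_contra! h
    exact hbot (eq_bot_iff.mpr fun x y => h x y)
  obtain ⟨z, hz⟩ : ∃ z, ¬ r x z := by
    by_contra! hall
    exact htop (Setoid.ext fun a b =>
      ⟨fun _ => trivial, fun _ => r.trans (r.symm (hall a)) (hall b)⟩)
  obtain ⟨s, hs⟩ := exists_powersetCard_two hne
  have hsr : ∀ u ∈ s, r x u := fun u hu => by
    rcases (hs u).mp hu with rfl | rfl
    exacts [r.refl _, hxy]
  -- A single pair is always a block. It is proper because transitivity carries `x` to `z`, outside
  -- the class that contains `s`.
  refine not_roadClosure_of_block s {s} rfl ?_ ?_ r htop ?_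
  · obtain ⟨g, rfl⟩ := MulAction.exists_smul_eq G x z
    refine ⟨g, fun h => hz (hsr _ ?_)⟩
    rw [← (show g • s = s from h)]
    exact mem_smul_powersetCard_iff.mpr ⟨x, (hs x).mpr (.inl rfl), rfl⟩
  · rintro g p - p' - rfl h rfl
    exact h
  · rintro _ ⟨g, rfl⟩ - u hu v hv
    obtain ⟨u, hus, rfl⟩ := mem_smul_powersetCard_iff.mp hu
    obtain ⟨v, hvs, rfl⟩ := mem_smul_powersetCard_iff.mp hv
    exact hr g u v (r.trans (r.symm (hsr u hus)) (hsr v hvs))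

theorem not_roadClosure_of_cartesianPower [Finite Ω] [MulAction.IsPreprimitive G Ω]
    (h : PreservesNontrivialCartesianPower G Ω) : ¬ RoadClosure G Ω := by
  obtain ⟨q, d, hq, hd, e, he⟩ := h
  choose σ τ hστ using he
  have : Nontrivial (Fin q) := Fin.nontrivial_iff_two_le.mpr hq
  have : Nontrivial (Fin d) := Fin.nontrivial_iff_two_le.mpr hd
  obtain ⟨a, b, hab⟩ := exists_pair_ne (Fin q)
  obtain ⟨i, j, hij⟩ := exists_pair_ne (Fin d)
  have hc : ∀ g x y i, e (g • x) i = e (g • y) i ↔ e x (σ g i) = e y (σ g i) := fun g x y i => by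
    rw [hστ, hστ, (τ g i).injective.eq_iff]
  have key : ∀ k l, e (e.symm fun _ => a) l = e (e.symm (Function.update (fun _ => a) k b)) l ↔
      l ≠ k := fun k l => by
    rw [e.apply_symm_apply, e.apply_symm_apply]
    obtain rfl | h := eq_or_ne l k
    · simpa using hab
    · simp [h]
  refine not_roadClosure_of_coordinates e (fun g => σ g) (fun g => (σ g).injective) hc (key i) ?_
  -- If every element fixed coordinate `i`, agreement in `i` would be an invariant relation. It is
  -- not equality, since points can differ only at `j`, and not universal, contradicting
  -- primitivity.
  by_contra! hfix
  refine not_preservesNontrivialPartition (G := G) (Ω := Ω)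
    ⟨Setoid.ker fun x => e x i, fun h => ?_, fun h => ?_, fun g x y hxy => ?_⟩
  · have h1 : (Setoid.ker fun x => e x i) _ _ := (key j i).mpr hij
    rw [h] at h1
    exact (key j j).mp (congrArg (fun z => e z j) h1) rfl
  · exact (key i i).mp (show (Setoid.ker fun x => e x i) _ _ from h ▸ trivial) rfl
  · exact (hc g x y i).mpr (by rw [hfix g]; exact hxy)

theorem not_roadClosure_of_index_two [Finite Ω] [MulAction.IsPreprimitive G Ω] {H : Subgroup G}
    (hH : H.index = 2) (h : PreservesNontrivialPartition H Ω) : ¬ RoadClosure G Ω := by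
  classical
  obtain ⟨r, hbot, htop, hrH⟩ := h
  have hr : ∀ g ∈ H, ∀ x y, r x y → r (g • x) (g • y) := fun g hg => hrH ⟨g, hg⟩
  obtain ⟨k, hk⟩ : ∃ k, k ∉ H := by
    by_contra! hall
    rw [(Subgroup.eq_top_iff' H).mpr hall, Subgroup.index_top] at hH
    exact absurd hH (by norm_num)
  have hk' : k⁻¹ ∉ H := fun h => hk (inv_mem_iff.mp h)
  have hmul : ∀ {a b : G}, a ∉ H → b ∉ H → a * b ∈ H := fun ha hb =>
    (Subgroup.mul_mem_iff_of_index_two hH).mpr (iff_of_false ha hb)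
  -- The translate of `r` by `k`. As `H` has index two, `k⁻¹ * g` and `g * k` lie in `H` for `g ∉
  -- H`, so such `g` swap `r` and `r'`.
  let r' : Setoid Ω := r.comap (k⁻¹ • ·)
  have hr' : ∀ {g}, g ∉ H → ∀ x y, r x y → r' (g • x) (g • y) := fun {g} hg x y h => by
    have := hr _ (hmul hk' hg) x y h
    rwa [mul_smul, mul_smul] at this
  have hr'' : ∀ {g}, g ∉ H → ∀ x y, r' x y → r (g • x) (g • y) := fun {g} hg x y h => by
    have := hr _ (hmul hg hk) _ _ (show r (k⁻¹ • x) (k⁻¹ • y) from h)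
    rwa [mul_smul, mul_smul, smul_inv_smul, smul_inv_smul] at this
  have hinv : ∀ (g : G) x y, (r ⊓ r') x y → (r ⊓ r') (g • x) (g • y) := by
    rintro g x y ⟨h1, h2⟩
    by_cases hg : g ∈ H
    · refine ⟨hr g hg x y h1, ?_⟩
      have hkg : k⁻¹ * g ∉ H := fun h => hk' ((Subgroup.mul_mem_cancel_right H hg).mp h)
      have := hr'' hkg x y h2
      rwa [mul_smul, mul_smul] at this
    · exact ⟨hr'' hg x y h2, hr' hg x y h1⟩
  -- The meet is invariant under all of `G`, so primitivity makes it trivial. Hence no pair lies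
  -- inside classes of both relations.
  have hinf : r ⊓ r' = ⊥ := by
    by_contra hne
    exact not_preservesNontrivialPartition (G := G) (Ω := Ω)
      ⟨r ⊓ r', hne, fun h => htop (inf_eq_top_iff.mp h).1, hinv⟩
  obtain ⟨x, y, hxy, hne⟩ : ∃ x y, r x y ∧ x ≠ y := by
    by_contra! h
    exact hbot (eq_bot_iff.mpr fun x y => h x y)
  obtain ⟨s, hs⟩ := exists_powersetCard_two hne
  have hsP : ∀ u ∈ s, ∀ v ∈ s, r u v := fun u hu v hv => by
    rcases (hs u).mp hu with rfl | rfl <;> rcases (hs v).mp hv with rfl | rfl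
    exacts [r.refl _, hxy, r.symm hxy, r.refl _]
  have hdisj : ∀ p : Set.powersetCard Ω 2, (∀ u ∈ p, ∀ v ∈ p, r u v) →
      ¬ ∀ u ∈ p, ∀ v ∈ p, r' u v := fun p h1 h2 => by
    obtain ⟨u, hu, v, hv, huv⟩ := exists_ne_mem_powersetCard_two p
    have h : (r ⊓ r') u v := ⟨h1 u hu v hv, h2 u hu v hv⟩
    rw [hinf] at h
    exact huv h
  have hmap : ∀ {g}, g ∉ H → ∀ p : Set.powersetCard Ω 2, (∀ u ∈ p, ∀ v ∈ p, r u v) →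
      ∀ u ∈ g • p, ∀ v ∈ g • p, r' u v := fun {g} hg p h u hu v hv => by
    obtain ⟨u, hus, rfl⟩ := mem_smul_powersetCard_iff.mp hu
    obtain ⟨v, hvs, rfl⟩ := mem_smul_powersetCard_iff.mp hv
    exact hr' hg u v (h u hus v hvs)
  have hmapH : ∀ {g}, g ∈ H → ∀ p : Set.powersetCard Ω 2, (∀ u ∈ p, ∀ v ∈ p, r u v) →
      ∀ u ∈ g • p, ∀ v ∈ g • p, r u v := fun {g} hg p h u hu v hv => by
    obtain ⟨u, hus, rfl⟩ := mem_smul_powersetCard_iff.mp hu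
    obtain ⟨v, hvs, rfl⟩ := mem_smul_powersetCard_iff.mp hv
    exact hr g hg u v (h u hus v hvs)
  refine not_roadClosure_of_block s {p | ∀ u ∈ p, ∀ v ∈ p, r u v} hsP
    ⟨k, fun h => hdisj _ h (hmap hk s hsP)⟩ (fun g p _ p' _ hp hgp hp' => ?_) r' (fun h => ?_) ?_
  · by_cases hg : g ∈ H
    · exact hmapH hg p' hp'
    · exact absurd (hmap hg p hp) (hdisj _ hgp)
  · refine htop (Setoid.ext fun u v => ⟨fun _ => trivial, fun _ => ?_⟩)
    have : r' (k • u) (k • v) := h ▸ trivial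
    simpa [r', Setoid.comap_rel] using this
  · rintro _ ⟨g, rfl⟩ hgs
    by_cases hg : g ∈ H
    · exact absurd (hmapH hg s hsP) hgs
    · exact hmap hg s hsP

end RoadClosureCriteria

/-! ### Triples of mutually incident objects of the polar space -/

section IncidentTriples

variable {F : Type*} [Field F]

instance [Finite F] : Finite (PolarObject F) :=
  Finite.of_injective (fun a : PolarObject F => (a.type, (a.space : Set (Space8 F)))) (by
    rintro ⟨i, U, _⟩ ⟨j, V, _⟩ h
    obtain ⟨rfl, h⟩ := Prod.mk.inj h
    obtain rfl := SetLike.coe_injective h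
    rfl)

instance [Finite F] : Finite (IncidentTriple F) :=
  Finite.of_injective IncidentTriple.obj fun _ _ => IncidentTriple.ext

variable (F) in
/-- The totally singular `4`-space where `y₁ = y₂ = y₃ = x₄ = 0`. -/
def oppositeSolid : Submodule F (Space8 F) where
  carrier := {v | v.1 3 = 0 ∧ v.2 0 = 0 ∧ v.2 1 = 0 ∧ v.2 2 = 0}
  add_mem' := by
    rintro v w ⟨h1, h2, h3, h4⟩ ⟨k1, k2, k3, k4⟩
    simp [h1, h2, h3, h4, k1, k2, k3, k4]
  zero_mem' := by simp
  smul_mem' := by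
    rintro c v ⟨h1, h2, h3, h4⟩
    simp [h1, h2, h3, h4]

theorem finrank_baseSolid : Module.finrank F (baseSolid : Submodule F (Space8 F)) = 4 := by
  rw [baseSolid, LinearMap.ker_snd, LinearMap.finrank_range_of_inj LinearMap.inl_injective]
  simp

theorem finrank_oppositeSolid : Module.finrank F (oppositeSolid F) = 4 := by
  -- The free coordinates are `x₁, x₂, x₃, y₄`.
  let e : oppositeSolid F ≃ₗ[F] (Fin 4 → F) :=
    { toFun := fun v => ![v.1.1 0, v.1.1 1, v.1.1 2, v.1.2 3]
      map_add' := fun v w => by ext i; fin_cases i <;> rfl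
      map_smul' := fun c v => by ext i; fin_cases i <;> rfl
      invFun := fun a => ⟨(![a 0, a 1, a 2, 0], ![0, 0, 0, a 3]), rfl, rfl, rfl, rfl⟩
      left_inv := by
        rintro ⟨⟨x, y⟩, h1, h2, h3, h4⟩
        refine Subtype.ext (Prod.ext ?_ ?_) <;> ext i <;> fin_cases i <;>
          first | rfl | exact h1.symm | exact h2.symm | exact h3.symm | exact h4.symm
      right_inv := fun a => by ext i; fin_cases i <;> rfl }
  rw [e.finrank_eq, Module.finrank_fin_fun]

theorem finrank_oppositeSolid_inf_baseSolid :
    Module.finrank F ↥(oppositeSolid F ⊓ baseSolid) = 3 := by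
  let e : ↥(oppositeSolid F ⊓ baseSolid) ≃ₗ[F] (Fin 3 → F) :=
    { toFun := fun v => ![v.1.1 0, v.1.1 1, v.1.1 2]
      map_add' := fun v w => by ext i; fin_cases i <;> rfl
      map_smul' := fun c v => by ext i; fin_cases i <;> rfl
      invFun := fun a => ⟨(![a 0, a 1, a 2, 0], 0), ⟨rfl, rfl, rfl, rfl⟩, rfl⟩
      left_inv := by
        rintro ⟨⟨x, y⟩, ⟨h1, h2, h3, h4⟩, h5⟩
        have h6 : y = 0 := h5
        refine Subtype.ext (Prod.ext ?_ h6.symm)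
        ext i
        fin_cases i <;> first | rfl | exact h1.symm
      right_inv := fun a => by ext i; fin_cases i <;> rfl }
  rw [e.finrank_eq, Module.finrank_fin_fun]

theorem totallySingular_baseSolid : TotallySingular (baseSolid : Submodule F (Space8 F)) := by
  intro v hv
  have h : v.2 = 0 := hv
  simp [hypForm, h]

theorem totallySingular_oppositeSolid : TotallySingular (oppositeSolid F) := by
  rintro v ⟨h1, h2, h3, h4⟩
  simp [hypForm, Fin.sum_univ_four, h1, h2, h3, h4]

/-- The vector of `F⁴ × 0` with coordinate `1` at `k`. -/
def baseVector (k : Fin 4) : Space8 F := (Pi.single k 1, 0)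

theorem baseVector_ne_zero (k : Fin 4) : (baseVector k : Space8 F) ≠ 0 := fun h => by
  simpa [baseVector] using congrFun (congrArg Prod.fst h) k

theorem baseVector_mem_baseSolid (k : Fin 4) : (baseVector k : Space8 F) ∈ baseSolid := rfl

theorem baseVector_mem_oppositeSolid {k : Fin 4} (hk : k ≠ 3) :
    (baseVector k : Space8 F) ∈ oppositeSolid F :=
  ⟨by simp [baseVector, hk.symm], rfl, rfl, rfl⟩

/-- The incident triple consisting of the point spanned by `baseVector k`, the solid `baseSolid` and
the solid `oppositeSolid`. -/
def coordinateTriple (k : Fin 4) (hk : k ≠ 3) : IncidentTriple F where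
  obj := ![
    { type := 0
      space := F ∙ baseVector k
      isObject := ⟨fun v hv => totallySingular_baseSolid v
        ((Submodule.span_singleton_le_iff_mem _ _).mpr (baseVector_mem_baseSolid k) hv),
        .inl ⟨rfl, finrank_span_singleton (baseVector_ne_zero k)⟩⟩ },
    { type := 1
      space := baseSolid
      isObject := ⟨totallySingular_baseSolid, .inr (.inl ⟨rfl, finrank_baseSolid, by
        rw [inf_idem, finrank_baseSolid]
        decide⟩)⟩ },
    { type := 2
      space := oppositeSolid F
      isObject := ⟨totallySingular_oppositeSolid, .inr (.inr ⟨rfl, finrank_oppositeSolid, by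
        rw [finrank_oppositeSolid_inf_baseSolid]
        decide⟩)⟩ }]
  type_obj i := by fin_cases i <;> rfl
  incident i j := by
    have h1 : F ∙ (baseVector k : Space8 F) ≤ baseSolid :=
      (Submodule.span_singleton_le_iff_mem _ _).mpr (baseVector_mem_baseSolid k)
    have h2 : F ∙ (baseVector k : Space8 F) ≤ oppositeSolid F :=
      (Submodule.span_singleton_le_iff_mem _ _).mpr (baseVector_mem_oppositeSolid hk)
    have h3 := finrank_oppositeSolid_inf_baseSolid (F := F)
    have h4 := h3
    rw [inf_comm] at h4
    fin_cases i <;> fin_cases j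
    exacts [.inl le_rfl, .inl h1, .inl h2, .inr (.inl h1), .inl le_rfl, .inr (.inr h4),
      .inr (.inl h2), .inr (.inr h3), .inl le_rfl]

theorem coordinateTriple_obj_eq_iff {k l : Fin 4} (hk : k ≠ 3) (hl : l ≠ 3) (hkl : k ≠ l)
    (i : Fin 3) : (coordinateTriple k hk : IncidentTriple F).obj i =
      (coordinateTriple l hl).obj i ↔ i ≠ 0 := by
  fin_cases i
  · refine iff_of_false (fun h => ?_) (fun h => h rfl)
    have hspace : F ∙ (baseVector k : Space8 F) = F ∙ baseVector l :=
      congrArg PolarObject.space h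
    have hmem : (baseVector k : Space8 F) ∈ F ∙ baseVector l :=
      hspace ▸ Submodule.mem_span_singleton_self _
    obtain ⟨a, ha⟩ := Submodule.mem_span_singleton.mp hmem
    simpa [baseVector, hkl] using congrFun (congrArg Prod.fst ha) k
  · exact iff_of_true rfl (by decide)
  · exact iff_of_true rfl (by decide)

/-- The two solids meet in the span of the first three base vectors, so the point can change while
both solids stay fixed. The inverse type permutation occurs because the action places at `i` the
image of the member of type `c⁻¹ i`. -/
theorem not_roadClosure_incidentTriple [Finite F] {G : Subgroup (Correlation F)}
    (hG : IsTrialityGroup G) : ¬ RoadClosure G (IncidentTriple F) := by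
  refine not_roadClosure_of_coordinates IncidentTriple.obj (fun g i => g.1.1.2⁻¹ i)
    (fun g => (g.1.1.2⁻¹).injective)
    (fun g x y i => g.1.1.1.injective.eq_iff)
    (coordinateTriple_obj_eq_iff (k := 0) (l := 1) (by decide) (by decide) (by decide)) ?_
  -- Any type permutation moving `0` would do; this one exchanges points with the first family of
  -- solids.
  have hmem : Equiv.swap (0 : Fin 3) 1 ∈ G.map (typeHom F) := hG.induces ▸ Subgroup.mem_top _
  obtain ⟨g, hg, h⟩ := hmem
  refine ⟨⟨g, hg⟩, ?_⟩
  change ((typeHom F g)⁻¹ : Equiv.Perm (Fin 3)) 0 ≠ 0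
  rw [h]
  decide

end IncidentTriples

theorem mainTheorem5 :
    -- (a) transitive imprimitive groups
    (∀ (Ω : Type*) [Finite Ω] (G : Subgroup (Equiv.Perm Ω)),
      MulAction.IsPretransitive G Ω → PreservesNontrivialPartition G Ω → ¬ RoadClosure G Ω) ∧
    -- (b) primitive non-basic groups
    (∀ (Ω : Type*) [Finite Ω] (G : Subgroup (Equiv.Perm Ω)),
      MulAction.IsPreprimitive G Ω → ¬ IsBasic G Ω → ¬ RoadClosure G Ω) ∧
    -- (c) primitive groups with an imprimitive normal subgroup of index 2
    (∀ (Ω : Type*) [Finite Ω] (G : Subgroup (Equiv.Perm Ω)),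
      MulAction.IsPreprimitive G Ω →
      ∀ H : Subgroup G, H.Normal → H.index = 2 → PreservesNontrivialPartition H Ω →
        ¬ RoadClosure G Ω) ∧
    -- (d) the action of `PΩ⁺(8,q) : S₃` on triples of a point and a solid from each family
    (∀ (F : Type*) [Field F] [Finite F] (G : Subgroup (Correlation F)),
      IsTrialityGroup G → ¬ RoadClosure G (IncidentTriple F)) := by
  refine ⟨fun Ω _ G _ h => not_roadClosure_of_imprimitive h, fun Ω _ G _ h => ?_,
    fun Ω _ G _ H _ hH h => not_roadClosure_of_index_two hH h,
    fun F _ _ G hG => not_roadClosure_incidentTriple hG⟩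
  exact not_roadClosure_of_cartesianPower (not_not.mp fun hn => h ⟨inferInstance, hn⟩)
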